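/- Let $\mathbf I$ be a corona graph: a finite, connected, simple plane graph whose edges (links) are oriented so that, for every face (including the two named next), all links on the boundary of the face circulate in the same direction around it, together with two distinct distinguished faces, the central face and the outer face. Assume that every face other than the central and the outer one is bounded by a polygon (its boundary walk visits no vertex twice). A circuit in $\mathbf I$ is a nonempty closed walk that follows the orientation of the links and uses no link twice. Its winding number is the algebraic number of its crossings with any line that goes from the central face to the outer face and avoids the vertices (counterclockwise counted positively), and it surrounds the central face if its winding number is nonzero. A decomposition of $\mathbf I$ is a family of circuits such that each link belongs to exactly one of them. A single oriented surrounding circuit is a circuit that surrounds the central face and belongs to a decomposition of $\mathbf I$ no other member of which surrounds the central face. A minimal Veblen decomposition is a decomposition of $\mathbf I$ into simple cycles each of which bounds one face of $\mathbf I$ other than the central face and the outer face. Then $\mathbf I$ contains a single oriented surrounding circuit if and only if $\mathbf I$ does not admit a minimal Veblen decomposition. Moreover the orientation of such circuits is fixed: there is $\varepsilon\in\{1,-1\}$, depending only on $\mathbf I$, such that every single oriented surrounding circuit of $\mathbf I$ has winding number $\varepsilon$. -/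

import Mathlib

/-- A rotation system on a simple graph: a permutation `rot` of the darts (directed edges) that
permutes the darts issued from each vertex in one single cycle.  It records the counterclockwise
cyclic order in which the edges leave each vertex in a drawing on an oriented surface. -/
structure RotationSystem {V : Type*} (G : SimpleGraph V) where
  rot : Equiv.Perm G.Dart
  rot_fst : ∀ d : G.Dart, (rot d).fst = d.fst
  rot_sameCycle : ∀ d e : G.Dart, d.fst = e.fst → rot.SameCycle d e

namespace RotationSystem

variable {V : Type*} {G : SimpleGraph V} (R : RotationSystem G)

/-- The face permutation: the dart that follows `d` on the boundary of the face lying on the left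
of `d`.  At the head of `d` one takes the dart that precedes (clockwise) the reverse of `d`. -/
def next : Equiv.Perm G.Dart :=
  (Function.Involutive.toPerm SimpleGraph.Dart.symm SimpleGraph.Dart.symm_involutive).trans
    R.rot.symm

/-- The faces of the embedded graph: the cycles of the face permutation. -/
def Face : Type _ := Quotient (Equiv.Perm.SameCycle.setoid R.next)

/-- The face on the left of the dart `d`; the face on its right is `R.left d.symm`. -/
def left (d : G.Dart) : R.Face := Quotient.mk (Equiv.Perm.SameCycle.setoid R.next) d

/-- Euler's formula `V - E + F = 2`: for a connected finite graph with at least one edge, the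
rotation system comes from a drawing on the sphere (equivalently, once one face is chosen as the
outer face, in the plane). -/
def IsPlanar [Fintype V] : Prop :=
  (Fintype.card V : ℤ) - (Nat.card G.edgeSet : ℤ) + (Nat.card R.Face : ℤ) = 2

/-- `l` is the list of darts crossed successively, each from its left to its right, by a line
that starts in the face `f`, avoids the vertices, and ends in the face `g`; in other words a walk
from `f` to `g` on the dual graph. -/
def IsDualWalk : R.Face → List G.Dart → R.Face → Prop
  | f, [], g => f = g
  | f, d :: l, g => R.left d = f ∧ IsDualWalk (R.left d.symm) l g

end RotationSystem

/-- A corona graph: a finite connected simple plane graph whose edges are oriented so that all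
the links on the boundary of any face (the central and the outer one included) circulate in the
same direction around that face, together with two distinct distinguished faces, the central
face and the outer face. -/
structure CoronaGraph (V : Type*) [Fintype V] where
  graph : SimpleGraph V
  connected : graph.Connected
  emb : RotationSystem graph
  planar : emb.IsPlanar
  /-- `IsLink d` says that the dart `d` is directed along the orientation of its edge. -/
  IsLink : graph.Dart → Prop
  isLink_symm : ∀ d, IsLink d.symm ↔ ¬ IsLink d
  /-- Two successive darts of a face boundary are both directed along, or both directed against,
  the orientation. -/
  coherent : ∀ d, IsLink (emb.next d) ↔ IsLink d
  central : emb.Face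
  outer : emb.Face
  central_ne_outer : central ≠ outer

namespace CoronaGraph

variable {V : Type*} [Fintype V] (I : CoronaGraph V)

/-- An oriented circuit: a nonempty closed walk that follows the orientation of the links and
uses no link twice (it may pass several times through a vertex). -/
structure Circuit where
  base : V
  walk : I.graph.Walk base base
  isCircuit : walk.IsCircuit
  oriented : ∀ d ∈ walk.darts, I.IsLink d

variable {I}

namespace Circuit

/-- A simple cycle: no vertex is repeated. -/
def IsSimple (γ : I.Circuit) : Prop := γ.walk.IsCycle

/-- The links of `γ` are exactly the links on the boundary of the face `f`. -/
def Bounds (γ : I.Circuit) (f : I.emb.Face) : Prop :=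
  ∀ d, d ∈ γ.walk.darts ↔ I.IsLink d ∧ (I.emb.left d = f ∨ I.emb.left d.symm = f)

open Classical in
/-- The algebraic number of crossings of `γ` with the line recorded by `l`: a link crossed from
its left to its right counts `+1`, a link crossed from its right to its left counts `-1`. -/
noncomputable def crossing (γ : I.Circuit) (l : List I.graph.Dart) : ℤ :=
  (l.map fun d => (if d ∈ γ.walk.darts then (1 : ℤ) else 0)
    - (if d.symm ∈ γ.walk.darts then (1 : ℤ) else 0)).sum

/-- The winding number of `γ` around the central face: its algebraic number of crossings with any
line from the central face to the outer face (counterclockwise counted positively). -/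
def HasWindingNumber (γ : I.Circuit) (w : ℤ) : Prop :=
  ∀ l, I.emb.IsDualWalk I.central l I.outer → γ.crossing l = w

/-- `γ` surrounds the central face: it has a nonzero winding number around it. -/
def Surrounds (γ : I.Circuit) : Prop := ∃ w : ℤ, w ≠ 0 ∧ γ.HasWindingNumber w

end Circuit

/-- A family of circuits that partitions the links of the graph. -/
def IsDecomposition (𝒟 : Set I.Circuit) : Prop :=
  ∀ d, I.IsLink d → ∃! γ : I.Circuit, γ ∈ 𝒟 ∧ d ∈ γ.walk.darts

/-- `γ` is a single surrounding circuit: it surrounds the central face and belongs to a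
decomposition of the graph into circuits no other member of which surrounds the central face. -/
def Circuit.IsSingleSurrounding (γ : I.Circuit) : Prop :=
  γ.Surrounds ∧ ∃ 𝒟 : Set I.Circuit, IsDecomposition 𝒟 ∧ γ ∈ 𝒟 ∧ ∀ δ ∈ 𝒟, δ.Surrounds → δ = γ

/-- A minimal Veblen decomposition: a decomposition into simple cycles each of which bounds one
face of the corona (the central hole and the exterior of the corona are excluded). -/
def IsMinimalVeblen (𝒟 : Set I.Circuit) : Prop :=
  IsDecomposition 𝒟 ∧ ∀ γ ∈ 𝒟, γ.IsSimple ∧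
    ∃ f : I.emb.Face, f ≠ I.central ∧ f ≠ I.outer ∧ γ.Bounds f

variable (I)

/-- Every face other than the central and the outer one is a polygon: going once around such a
face one meets no vertex twice. -/
def FacesArePolygons : Prop :=
  ∀ d e : I.graph.Dart, I.emb.left d = I.emb.left e → I.emb.left d ≠ I.central →
    I.emb.left d ≠ I.outer → d.fst = e.fst → d = e

end CoronaGraph

open Classical

/-! Coherence gives each face a sign, and every link has a positive face on its left and a negative
one on its right. So the boundaries of the positive faces form a decomposition, and so do those of
the negative faces. The indicator of the positive faces drops by 1 across each link; hence the
winding numbers in any decomposition add up to [central positive] - [outer positive]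
(`IsDecomposition.sum_crossing`).

If the two signs agree, this total is 0, which forbids a single surrounding circuit, and the faces
of the other sign give a minimal Veblen decomposition. If they differ, the total is ±1, which
forbids a minimal Veblen decomposition, since its members have winding number 0; among the positive
faces exactly one is distinguished, and its boundary is a single surrounding circuit. The total is
also the forced ε.

Planarity serves to make winding numbers independent of the line: by Euler's formula a circuit is
the difference of a potential on the faces. -/

theorem Equiv.Perm.SameCycle.iff_of_invariant {α : Type*} {p : Equiv.Perm α} {P : α → Prop}
    (hP : ∀ x, P (p x) ↔ P x) {x y : α} (h : p.SameCycle x y) : P x ↔ P y := by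
  obtain ⟨i, rfl⟩ := h
  induction i using Int.induction_on with
  | zero => simp
  | succ n ih => rw [add_comm, zpow_add, zpow_one, Equiv.Perm.mul_apply, hP]; exact ih
  | pred n ih =>
    rw [ih, ← hP ((p ^ (-(n : ℤ) - 1)) x), ← Equiv.Perm.mul_apply, ← zpow_one_add]
    simp

theorem SimpleGraph.Walk.sum_darts_map_sub {V A : Type*} [AddCommGroup A] {G : SimpleGraph V}
    (ψ : V → A) {u v : V} (w : G.Walk u v) :
    (w.darts.map fun d => ψ d.snd - ψ d.fst).sum = ψ v - ψ u := by
  induction w with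
  | nil => simp
  | cons h w ih => simp [ih]

/-- Iterating a map that sends each dart to one issued from its head gives a walk. -/
theorem SimpleGraph.exists_walk_darts_eq_iterate {V : Type*} {G : SimpleGraph V}
    (p : G.Dart → G.Dart) (hp : ∀ d, (p d).fst = d.snd) (k : ℕ) (d : G.Dart) :
    ∃ w : G.Walk d.fst (p^[k] d).fst, w.darts = List.iterate p d k := by
  induction k generalizing d with
  | zero => exact ⟨.nil, rfl⟩
  | succ k ih =>
    obtain ⟨w, hw⟩ := ih (p d)
    refine ⟨.cons d.adj (w.copy (hp d) (by rw [Function.iterate_succ_apply])), ?_⟩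
    rw [SimpleGraph.Walk.darts_cons, SimpleGraph.Walk.darts_copy, hw]
    rfl

/-! ### Face permutation and dual walks. -/

namespace RotationSystem

variable {V : Type*} {G : SimpleGraph V} (R : RotationSystem G)

theorem next_apply (d : G.Dart) : R.next d = R.rot.symm d.symm := rfl

theorem rot_symm_fst (d : G.Dart) : (R.rot.symm d).fst = d.fst := by
  simpa using (R.rot_fst (R.rot.symm d)).symm

theorem next_fst (d : G.Dart) : (R.next d).fst = d.snd := by
  rw [next_apply, rot_symm_fst]; rfl

theorem left_eq_left_iff {d e : G.Dart} : R.left d = R.left e ↔ R.next.SameCycle d e :=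
  Quotient.eq

theorem left_next (d : G.Dart) : R.left (R.next d) = R.left d :=
  R.left_eq_left_iff.2 (Equiv.Perm.sameCycle_apply_left.2 (.refl _ _))

theorem left_surjective : Function.Surjective R.left := Quotient.mk_surjective

instance [Finite V] : Finite R.Face :=
  have := Fintype.ofFinite V
  Finite.of_surjective _ R.left_surjective

/-- The dual graph of a connected embedded graph is connected. -/
theorem dual_connected (hG : G.Connected) (S : R.Face → Prop)
    (hS : ∀ d, S (R.left d) ↔ S (R.left d.symm)) {f : R.Face} (hf : S f) (g : R.Face) : S g := by
  obtain ⟨d, rfl⟩ := R.left_surjective f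
  obtain ⟨e, rfl⟩ := R.left_surjective g
  -- Neighbouring darts at a vertex have left faces separated by a single edge, so `S` spreads
  -- around each vertex, then along walks.
  have hrot : ∀ x, S (R.left (R.rot x)) ↔ S (R.left x) := fun x => by
    rw [hS, ← R.left_next, R.next_apply, SimpleGraph.Dart.symm_symm, Equiv.symm_apply_apply]
  have hv : ∀ x y : G.Dart, x.fst = y.fst → S (R.left x) → S (R.left y) := fun x y h =>
    ((R.rot_sameCycle x y h).iff_of_invariant (P := fun x => S (R.left x)) hrot).1
  have key : ∀ {u v : V} (_ : G.Walk u v), (∀ x : G.Dart, x.fst = u → S (R.left x)) →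
      ∀ x : G.Dart, x.fst = v → S (R.left x) := by
    intro u v w
    induction w with
    | nil => exact id
    | cons h w ih =>
      intro hu
      refine ih fun x hx => ?_
      exact hv (SimpleGraph.Dart.mk (_, _) h).symm x hx.symm ((hS _).1 (hu ⟨(_, _), h⟩ rfl))
  obtain ⟨w⟩ := hG.preconnected d.fst e.fst
  exact key w (fun x hx => hv d x hx.symm hf) e rfl

theorem IsDualWalk.append_singleton {R : RotationSystem G} {f : R.Face} {l : List G.Dart}
    {d : G.Dart} (h : R.IsDualWalk f l (R.left d)) :
    R.IsDualWalk f (l ++ [d]) (R.left d.symm) := by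
  induction l generalizing f with
  | nil => exact ⟨h.symm, rfl⟩
  | cons e l ih => exact ⟨h.1, ih h.2⟩

theorem exists_isDualWalk (hG : G.Connected) (f g : R.Face) : ∃ l, R.IsDualWalk f l g := by
  refine R.dual_connected hG (fun g => ∃ l, R.IsDualWalk f l g) (fun d => ⟨?_, ?_⟩)
    (f := f) ⟨[], rfl⟩ g
  · rintro ⟨l, hl⟩
    exact ⟨_, hl.append_singleton⟩
  · rintro ⟨l, hl⟩
    exact ⟨_, hl.append_singleton⟩

theorem IsDualWalk.sum_map_sub {A : Type*} [AddCommGroup A] {R : RotationSystem G}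
    (φ : R.Face → A) {f g : R.Face} {l : List G.Dart} (h : R.IsDualWalk f l g) :
    (l.map fun d => φ (R.left d) - φ (R.left d.symm)).sum = φ f - φ g := by
  induction l generalizing f with
  | nil => simp [show f = g from h]
  | cons d l ih => simp [ih h.2, h.1]

/-- Around each face the differences of `ψ` telescope: `next` keeps the left face and turns heads
into tails. -/
theorem sum_left_mul_sub [Fintype V] (φ : R.Face → ℚ) (ψ : V → ℚ) :
    ∑ d : G.Dart, φ (R.left d) * (ψ d.snd - ψ d.fst) = 0 := by
  have h := Equiv.sum_comp R.next fun d => φ (R.left d) * ψ d.fst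
  simp only [left_next, next_fst] at h
  simp only [mul_sub, Finset.sum_sub_distrib, h, sub_self]

end RotationSystem

/-! ### Signs of faces; face and vertex differences. -/

namespace CoronaGraph

variable {V : Type*} [Fintype V] (I : CoronaGraph V)

/-- The faces around which the links circulate counterclockwise. -/
def IsPositive (f : I.emb.Face) : Prop := ∃ d, I.emb.left d = f ∧ I.IsLink d

@[simp]
theorem isPositive_left {d : I.graph.Dart} : I.IsPositive (I.emb.left d) ↔ I.IsLink d := by
  refine ⟨fun ⟨e, h, he⟩ => ?_, fun h => ⟨d, rfl, h⟩⟩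
  exact ((I.emb.left_eq_left_iff.1 h).iff_of_invariant I.coherent).1 he

variable {I}

theorem IsLink.not_symm {d : I.graph.Dart} (h : I.IsLink d) : ¬ I.IsLink d.symm :=
  fun h' => (I.isLink_symm d).1 h' h

theorem IsLink.symm_of_not {d : I.graph.Dart} (h : ¬ I.IsLink d) : I.IsLink d.symm :=
  (I.isLink_symm d).2 h

theorem card_links : Fintype.card {d // I.IsLink d} = Nat.card I.graph.edgeSet := by
  rw [← Nat.card_eq_fintype_card]
  refine Nat.card_eq_of_bijective (fun d => ⟨d.1.edge, d.1.edge_mem⟩) ⟨?_, ?_⟩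
  · rintro ⟨d, hd⟩ ⟨e, he⟩ h
    rcases SimpleGraph.dart_edge_eq_iff d e |>.1 (congrArg Subtype.val h) with h | h
    · exact Subtype.ext h
    · exact absurd (h ▸ hd) he.not_symm
  · rintro ⟨e, he⟩
    induction e using Sym2.ind with
    | _ u v =>
      let d : I.graph.Dart := ⟨(u, v), he⟩
      by_cases hd : I.IsLink d
      · exact ⟨⟨d, hd⟩, rfl⟩
      · exact ⟨⟨d.symm, IsLink.symm_of_not hd⟩, Subtype.ext d.edge_symm⟩

theorem sum_darts {A : Type*} [AddCommMonoid A] (F : I.graph.Dart → A) :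
    ∑ d, F d = ∑ d : {d // I.IsLink d}, (F d + F d.1.symm) := by
  rw [Finset.sum_add_distrib, ← Fintype.sum_subtype_add_sum_subtype I.IsLink F]
  congr 1
  refine (Fintype.sum_equiv ⟨fun d => ⟨d.1.symm, d.2.not_symm⟩,
    fun d => ⟨d.1.symm, IsLink.symm_of_not d.2⟩, fun d => by simp, fun d => by simp⟩ _ _ ?_).symm
  intro d
  rfl

variable (I) in
/-- The differences of a function on the faces across the links. -/
def faceDiff : (I.emb.Face → ℚ) →ₗ[ℚ] ({d // I.IsLink d} → ℚ) where
  toFun φ d := φ (I.emb.left d) - φ (I.emb.left d.1.symm)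
  map_add' _ _ := by ext; simp only [Pi.add_apply]; ring
  map_smul' _ _ := by ext; simp only [Pi.smul_apply, smul_eq_mul, RingHom.id_apply]; ring

variable (I) in
/-- The differences of a function on the vertices along the links. -/
def vertexDiff : (V → ℚ) →ₗ[ℚ] ({d // I.IsLink d} → ℚ) where
  toFun ψ d := ψ d.1.snd - ψ d.1.fst
  map_add' _ _ := by ext; simp only [Pi.add_apply]; ring
  map_smul' _ _ := by ext; simp only [Pi.smul_apply, smul_eq_mul, RingHom.id_apply]; ring

theorem sum_faceDiff_mul_vertexDiff (φ : I.emb.Face → ℚ) (ψ : V → ℚ) :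
    ∑ d, I.faceDiff φ d * I.vertexDiff ψ d = 0 := by
  rw [← I.emb.sum_left_mul_sub φ ψ, sum_darts]
  refine Finset.sum_congr rfl fun d _ => ?_
  simp only [faceDiff, vertexDiff, LinearMap.coe_mk, AddHom.coe_mk, SimpleGraph.Dart.symm_toProd,
    Prod.fst_swap, Prod.snd_swap]
  ring

/-- Rank-nullity, the kernel being at most the line of constants. -/
theorem card_le_finrank_range_add_one {α W : Type*} [Fintype α] [AddCommGroup W] [Module ℚ W]
    (T : (α → ℚ) →ₗ[ℚ] W) (hT : ∀ φ, T φ = 0 → ∀ a b, φ a = φ b) :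
    Fintype.card α ≤ Module.finrank ℚ (LinearMap.range T) + 1 := by
  have h1 := T.finrank_range_add_finrank_ker
  rw [Module.finrank_fintype_fun_eq_card] at h1
  have h2 : LinearMap.ker T ≤ Submodule.span ℚ {fun _ => (1 : ℚ)} := by
    intro φ hφ
    rw [Submodule.mem_span_singleton]
    rcases isEmpty_or_nonempty α with h | ⟨⟨a⟩⟩
    · exact ⟨0, Subsingleton.elim _ _⟩
    · exact ⟨φ a, funext fun b => by simpa using hT φ hφ a b⟩
  have h3 := (Submodule.finrank_mono h2).trans (finrank_span_le_card _)
  simp only [Set.toFinset_singleton, Finset.card_singleton] at h3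
  omega

theorem eq_of_faceDiff_eq_zero {φ : I.emb.Face → ℚ} (h : I.faceDiff φ = 0) (f g : I.emb.Face) :
    φ f = φ g := by
  have hl : ∀ d, I.IsLink d → φ (I.emb.left d) = φ (I.emb.left d.symm) := fun d hd =>
    sub_eq_zero.1 (congrFun h ⟨d, hd⟩)
  refine I.emb.dual_connected I.connected (fun g => φ f = φ g) (fun d => ?_) rfl g
  by_cases hd : I.IsLink d
  · rw [hl d hd]
  · have := hl d.symm (IsLink.symm_of_not hd)
    rw [SimpleGraph.Dart.symm_symm] at this
    rw [this]

theorem eq_of_vertexDiff_eq_zero {ψ : V → ℚ} (h : I.vertexDiff ψ = 0) (u v : V) : ψ u = ψ v := by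
  have hl : ∀ d : I.graph.Dart, I.IsLink d → ψ d.snd = ψ d.fst := fun d hd =>
    sub_eq_zero.1 (congrFun h ⟨d, hd⟩)
  obtain ⟨w⟩ := I.connected.preconnected u v
  induction w with
  | nil => rfl
  | cons hadj w ih =>
    rw [← ih]
    by_cases hd : I.IsLink ⟨(_, _), hadj⟩
    · exact (hl _ hd).symm
    · exact hl _ (IsLink.symm_of_not hd)

/-- On a plane graph every function on the links splits into the differences of a function on the
faces and those of a function on the vertices. -/
theorem range_faceDiff_sup_range_vertexDiff :
    LinearMap.range I.faceDiff ⊔ LinearMap.range I.vertexDiff = ⊤ := by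
  let := Fintype.ofFinite I.emb.Face
  have hF := card_le_finrank_range_add_one I.faceDiff fun _ => eq_of_faceDiff_eq_zero
  have hV := card_le_finrank_range_add_one I.vertexDiff fun _ => eq_of_vertexDiff_eq_zero
  -- The ranges are orthogonal for a positive definite form, and their dimensions, at least F - 1
  -- and V - 1, add up to at least E by Euler's formula.
  have hinf : LinearMap.range I.faceDiff ⊓ LinearMap.range I.vertexDiff = ⊥ := by
    rw [eq_bot_iff]
    rintro x ⟨⟨φ, hφ⟩, ⟨ψ, hψ⟩⟩
    have h := sum_faceDiff_mul_vertexDiff φ ψ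
    rw [hφ, hψ, Finset.sum_eq_zero_iff_of_nonneg fun _ _ => mul_self_nonneg _] at h
    exact (Submodule.mem_bot ℚ).2 (funext fun d => mul_self_eq_zero.1 (h d (Finset.mem_univ _)))
  have hsum := Submodule.finrank_sup_add_finrank_inf_eq (LinearMap.range I.faceDiff)
    (LinearMap.range I.vertexDiff)
  rw [hinf, finrank_bot] at hsum
  have hE := I.planar
  rw [RotationSystem.IsPlanar, ← card_links, Nat.card_eq_fintype_card] at hE
  apply Submodule.eq_top_of_finrank_eq
  have hle := Submodule.finrank_le (LinearMap.range I.faceDiff ⊔ LinearMap.range I.vertexDiff)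
  rw [Module.finrank_fintype_fun_eq_card] at hle ⊢
  omega

/-! ### Winding numbers. -/

namespace Circuit

variable (γ : I.Circuit)

theorem darts_nodup : γ.walk.darts.Nodup := γ.isCircuit.isTrail.edges_nodup.of_map _

theorem exists_mem_darts : ∃ d, d ∈ γ.walk.darts := by
  refine List.exists_mem_of_ne_nil _ fun h => γ.isCircuit.ne_nil ?_
  rwa [SimpleGraph.Walk.darts_eq_nil, ← SimpleGraph.Walk.eq_nil_iff_nil] at h

theorem sum_mem_mul_vertexDiff (ψ : V → ℚ) :
    ∑ d : {d // I.IsLink d}, (if d.1 ∈ γ.walk.darts then (1 : ℚ) else 0) * I.vertexDiff ψ d = 0 := by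
  have h := γ.walk.sum_darts_map_sub ψ
  rw [sub_self, ← List.sum_toFinset _ γ.darts_nodup] at h
  rw [← Finset.sum_subtype_of_mem (p := I.IsLink) _
    fun d hd => γ.oriented d (List.mem_toFinset.1 hd)] at h
  simp only [ite_mul, one_mul, zero_mul]
  rw [← Finset.sum_filter, ← h]
  refine Finset.sum_congr ?_ fun _ _ => rfl
  ext d
  simp

theorem crossing_of_potential {A : Type*} [AddCommGroupWithOne A] (φ : I.emb.Face → A)
    (hφ : ∀ d, I.IsLink d → φ (I.emb.left d) - φ (I.emb.left d.symm) =
      if d ∈ γ.walk.darts then 1 else 0) {f g : I.emb.Face} {l : List I.graph.Dart}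
    (h : I.emb.IsDualWalk f l g) : (γ.crossing l : A) = φ f - φ g := by
  rw [← h.sum_map_sub φ, crossing]
  refine (map_list_sum (Int.castAddHom A) _).trans ?_
  rw [List.map_map]
  congr 1
  refine List.map_congr_left fun d _ => ?_
  by_cases hd : I.IsLink d
  · have h2 : d.symm ∉ γ.walk.darts := fun h => hd.not_symm (γ.oriented _ h)
    rw [hφ d hd]
    simp [h2]
  · have h2 : d ∉ γ.walk.darts := fun h => hd (γ.oriented _ h)
    have h3 := hφ d.symm (IsLink.symm_of_not hd)
    rw [SimpleGraph.Dart.symm_symm] at h3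
    rw [← neg_sub, h3]
    simp [h2]

/-- The winding number does not depend on the line. -/
theorem exists_hasWindingNumber : ∃ w, γ.HasWindingNumber w := by
  let χ : {d // I.IsLink d} → ℚ := fun d => if d.1 ∈ γ.walk.darts then 1 else 0
  have hχ : χ ∈ LinearMap.range I.faceDiff ⊔ LinearMap.range I.vertexDiff := by
    rw [range_faceDiff_sup_range_vertexDiff]; trivial
  obtain ⟨_, ⟨φ, rfl⟩, _, ⟨ψ, rfl⟩, h⟩ := Submodule.mem_sup.1 hχ
  -- A closed walk is orthogonal to all vertex differences, so its `ψ` component has norm zero.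
  have h0 : ∑ d, I.vertexDiff ψ d * I.vertexDiff ψ d = 0 := by
    have h1 : ∑ d, χ d * I.vertexDiff ψ d = 0 := γ.sum_mem_mul_vertexDiff ψ
    rw [← h] at h1
    simpa [add_mul, Finset.sum_add_distrib, sum_faceDiff_mul_vertexDiff] using h1
  rw [Finset.sum_eq_zero_iff_of_nonneg fun _ _ => mul_self_nonneg _] at h0
  have hφ : I.faceDiff φ = χ := by
    rw [← h]
    ext d
    simpa using h0 d (Finset.mem_univ _)
  have key := fun l (hl : I.emb.IsDualWalk I.central l I.outer) =>
    γ.crossing_of_potential φ (fun d hd => congrFun hφ ⟨d, hd⟩) hl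
  obtain ⟨l, hl⟩ := I.emb.exists_isDualWalk I.connected I.central I.outer
  exact ⟨γ.crossing l, fun l' hl' => by exact_mod_cast (key l' hl').trans (key l hl).symm⟩

variable {γ}

theorem crossing_eq_zero_of_not_surrounds (h : ¬ γ.Surrounds) {l : List I.graph.Dart}
    (hl : I.emb.IsDualWalk I.central l I.outer) : γ.crossing l = 0 := by
  obtain ⟨w, hw⟩ := γ.exists_hasWindingNumber
  by_contra h0
  exact h ⟨w, hw l hl ▸ h0, hw⟩

/-- The indicator of `f`, signed by the side on which the links see `f`, is a potential for `γ`. -/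
theorem Bounds.crossing {f : I.emb.Face} (hf : γ.Bounds f) {g h : I.emb.Face}
    {l : List I.graph.Dart} (hl : I.emb.IsDualWalk g l h) :
    γ.crossing l = (if I.IsPositive f then 1 else -1) *
      ((if g = f then 1 else 0) - (if h = f then 1 else 0)) := by
  rw [mul_sub, ← γ.crossing_of_potential
    (fun g => (if I.IsPositive f then (1 : ℤ) else -1) * (if g = f then 1 else 0)) _ hl,
    Int.cast_id]
  intro d hd
  have h1 := hd.not_symm
  rw [← isPositive_left] at hd h1
  have h2 := hf d
  rw [← isPositive_left] at h2
  split_ifs <;> simp_all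

end Circuit

/-! ### Decompositions. -/

theorem IsDecomposition.finite {𝒟 : Set I.Circuit} (h : IsDecomposition 𝒟) : 𝒟.Finite := by
  choose c hc using fun d : {d // I.IsLink d} => h d.1 d.2
  refine (Set.finite_range c).subset fun γ hγ => ?_
  obtain ⟨d, hd⟩ := γ.exists_mem_darts
  exact ⟨⟨d, γ.oriented d hd⟩, ((hc _).2 γ ⟨hγ, hd⟩).symm⟩

theorem IsDecomposition.sum_mem {𝒟 : Set I.Circuit} (h : IsDecomposition 𝒟) (d : I.graph.Dart) :
    ∑ γ ∈ h.finite.toFinset, (if d ∈ γ.walk.darts then (1 : ℤ) else 0) =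
      if I.IsLink d then 1 else 0 := by
  split_ifs with hd
  · obtain ⟨γ, ⟨hγ, hdγ⟩, huniq⟩ := h d hd
    rw [Finset.sum_eq_single_of_mem γ (by simpa using hγ), if_pos hdγ]
    intro δ hδ hne
    exact if_neg fun hdδ => hne (huniq δ ⟨by simpa using hδ, hdδ⟩)
  · exact Finset.sum_eq_zero fun γ _ => if_neg fun h' => hd (γ.oriented d h')

/-- The winding numbers of a decomposition add up to a number fixed by the two distinguished
faces. -/
theorem IsDecomposition.sum_crossing {𝒟 : Set I.Circuit} (h : IsDecomposition 𝒟)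
    {f g : I.emb.Face} {l : List I.graph.Dart} (hl : I.emb.IsDualWalk f l g) :
    ∑ γ ∈ h.finite.toFinset, γ.crossing l =
      (if I.IsPositive f then 1 else 0) - (if I.IsPositive g then 1 else 0) := by
  rw [← hl.sum_map_sub fun f => if I.IsPositive f then (1 : ℤ) else 0]
  simp only [isPositive_left, ← h.sum_mem]
  clear hl
  induction l with
  | nil => simp [Circuit.crossing]
  | cons d l ih =>
    simp only [List.map_cons, List.sum_cons, ← ih, Circuit.crossing, Finset.sum_add_distrib,
      Finset.sum_sub_distrib]

/-- The orbits of a permutation of the darts that follows the links form a decomposition. -/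
theorem exists_isDecomposition (p : Equiv.Perm I.graph.Dart) (hp : ∀ d, (p d).fst = d.snd)
    (hlink : ∀ d, I.IsLink (p d) ↔ I.IsLink d) :
    ∃ 𝒟 : Set I.Circuit, IsDecomposition 𝒟 ∧
      ∀ γ ∈ 𝒟, ∃ d, I.IsLink d ∧ ∀ e, e ∈ γ.walk.darts ↔ p.SameCycle d e := by
  have hex : ∀ d : I.graph.Dart, I.IsLink d →
      ∃ γ : I.Circuit, ∀ e, e ∈ γ.walk.darts ↔ p.SameCycle d e := by
    intro d hd
    have hd' : d ∈ Function.periodicPts p :=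
      Function.Injective.mem_periodicPts p.injective d
    have hpos := Function.minimalPeriod_pos_of_mem_periodicPts hd'
    obtain ⟨w, hw⟩ := SimpleGraph.exists_walk_darts_eq_iterate p hp (Function.minimalPeriod p d) d
    have hend : (p^[Function.minimalPeriod p d] d).fst = d.fst := by
      rw [Function.iterate_minimalPeriod]
    have hmem : ∀ e, e ∈ List.iterate p d (Function.minimalPeriod p d) ↔ p.SameCycle d e := by
      intro e
      rw [List.mem_iterate]
      constructor
      · rintro ⟨m, _, rfl⟩
        exact ⟨m, by simp [← Equiv.Perm.iterate_eq_pow]⟩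
      · intro h
        obtain ⟨i, -, rfl⟩ := h.exists_pow_eq'
        refine ⟨i % Function.minimalPeriod p d, Nat.mod_lt _ hpos, ?_⟩
        rw [Function.iterate_mod_minimalPeriod_eq, Equiv.Perm.iterate_eq_pow]
    have hor : ∀ e, p.SameCycle d e → I.IsLink e := fun e he => (he.iff_of_invariant hlink).1 hd
    have hnd : (List.iterate p d (Function.minimalPeriod p d)).Nodup := by
      rw [← List.range_map_iterate]
      refine List.nodup_range.map_on fun m hm n hn h => ?_
      exact Function.iterate_injOn_Iio_minimalPeriod (List.mem_range.1 hm) (List.mem_range.1 hn) h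
    refine ⟨⟨d.fst, w.copy rfl hend, ?_, ?_⟩, ?_⟩
    · refine ⟨⟨?_⟩, ?_⟩
      · rw [SimpleGraph.Walk.edges_copy, SimpleGraph.Walk.edges, hw]
        refine hnd.map_on fun a ha b hb hab => ?_
        rcases SimpleGraph.dart_edge_eq_iff a b |>.1 hab with h | h
        · exact h
        · exact absurd (h ▸ hor _ ((hmem a).1 ha)) (hor _ ((hmem b).1 hb)).not_symm
      · intro h
        have h2 := congrArg SimpleGraph.Walk.darts h
        rw [SimpleGraph.Walk.darts_copy, hw] at h2
        have h3 := (hmem d).2 (.refl _ _)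
        rw [h2] at h3
        simp at h3
    · intro e he
      rw [SimpleGraph.Walk.darts_copy, hw, hmem] at he
      exact hor e he
    · intro e
      rw [SimpleGraph.Walk.darts_copy, hw, hmem]
  choose c hc using hex
  -- One base dart per orbit: the same orbit based elsewhere may be a different `Circuit`, which
  -- would break uniqueness.
  let r : I.graph.Dart → I.graph.Dart := fun d =>
    (Quotient.mk (Equiv.Perm.SameCycle.setoid p) d).out
  have hr : ∀ d, p.SameCycle (r d) d := fun d =>
    Quotient.mk_out (s := Equiv.Perm.SameCycle.setoid p) d
  have hr' : ∀ d e, p.SameCycle d e → r d = r e := fun d e h =>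
    congrArg Quotient.out (Quotient.sound (s := Equiv.Perm.SameCycle.setoid p) h)
  have hrl : ∀ d, I.IsLink d → I.IsLink (r d) := fun d hd =>
    ((hr d).iff_of_invariant hlink).2 hd
  refine ⟨{γ | ∃ d, ∃ hd : I.IsLink d, γ = c (r d) (hrl d hd)}, ?_, ?_⟩
  · intro d hd
    refine ⟨c (r d) (hrl d hd), ⟨⟨d, hd, rfl⟩, (hc _ _ _).2 (hr d)⟩, ?_⟩
    rintro _ ⟨⟨e, he, rfl⟩, h⟩
    rw [hc] at h
    have := hr' e d ((hr e).symm.trans h)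
    congr
  · rintro _ ⟨d, hd, rfl⟩
    exact ⟨r d, hrl d hd, hc _ _⟩

theorem exists_isDecomposition_positive :
    ∃ 𝒟 : Set I.Circuit, IsDecomposition 𝒟 ∧
      ∀ γ ∈ 𝒟, ∃ f, I.IsPositive f ∧ γ.Bounds f := by
  obtain ⟨𝒟, h𝒟, h⟩ := exists_isDecomposition I.emb.next I.emb.next_fst I.coherent
  refine ⟨𝒟, h𝒟, fun γ hγ => ?_⟩
  obtain ⟨d, hd, h⟩ := h γ hγ
  refine ⟨I.emb.left d, by simpa using hd, fun e => ?_⟩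
  rw [h, ← I.emb.left_eq_left_iff]
  have h1 := I.isPositive_left (d := d)
  constructor
  · intro h2
    rw [h2, isPositive_left] at h1
    exact ⟨h1.2 hd, .inl h2.symm⟩
  · rintro ⟨he, h2 | h2⟩
    · exact h2.symm
    · rw [← h2, isPositive_left] at h1
      exact absurd (h1.2 hd) he.not_symm

/-- Conjugating the inverse of `next` by reversal follows the face on the right of each link. -/
theorem exists_isDecomposition_negative :
    ∃ 𝒟 : Set I.Circuit, IsDecomposition 𝒟 ∧
      ∀ γ ∈ 𝒟, ∃ f, ¬ I.IsPositive f ∧ γ.Bounds f := by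
  let s : Equiv.Perm I.graph.Dart :=
    Function.Involutive.toPerm SimpleGraph.Dart.symm SimpleGraph.Dart.symm_involutive
  have hs : ∀ d, s⁻¹ d = d.symm := fun d => rfl
  have happly : ∀ d, (s * I.emb.next⁻¹ * s⁻¹) d = (I.emb.next.symm d.symm).symm := fun d => rfl
  obtain ⟨𝒟, h𝒟, h⟩ := exists_isDecomposition (s * I.emb.next⁻¹ * s⁻¹)
    (fun d => by
      have := I.emb.next_fst (I.emb.next.symm d.symm)
      rw [Equiv.apply_symm_apply] at this
      exact this.symm)
    (fun d => by
      have := I.coherent (I.emb.next.symm d.symm)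
      rw [Equiv.apply_symm_apply] at this
      rw [happly, I.isLink_symm, ← this, I.isLink_symm, not_not])
  refine ⟨𝒟, h𝒟, fun γ hγ => ?_⟩
  obtain ⟨d, hd, h⟩ := h γ hγ
  refine ⟨I.emb.left d.symm, by simpa using hd.not_symm, fun e => ?_⟩
  rw [h, Equiv.Perm.sameCycle_conj, Equiv.Perm.sameCycle_inv, hs, hs, ← I.emb.left_eq_left_iff]
  have h1 := I.isPositive_left (d := d.symm)
  constructor
  · intro h2
    rw [h2, isPositive_left] at h1
    have h3 : ¬ I.IsLink e.symm := fun h => hd.not_symm (h1.1 h)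
    exact ⟨by simpa using IsLink.symm_of_not h3, .inr h2.symm⟩
  · rintro ⟨he, h2 | h2⟩
    · rw [← h2, isPositive_left] at h1
      exact absurd (h1.1 he) hd.not_symm
    · exact h2.symm

/-! ### The dichotomy on the signs of the distinguished faces. -/

theorem Circuit.Bounds.isSimple (hpoly : I.FacesArePolygons) {γ : I.Circuit} {f : I.emb.Face}
    (h : γ.Bounds f) (hc : f ≠ I.central) (ho : f ≠ I.outer) : γ.IsSimple := by
  refine ⟨γ.isCircuit, ?_⟩
  rw [← SimpleGraph.Walk.map_snd_darts]
  refine γ.darts_nodup.map_on fun a ha b hb hab => ?_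
  obtain ⟨hla, ha⟩ := (h a).1 ha
  obtain ⟨hlb, hb⟩ := (h b).1 hb
  -- Two links with a common head yield two darts of `f` with a common tail: their successors if `f`
  -- is on the left, their reverses if it is on the right.
  by_cases hf : I.IsPositive f
  · have ha' : I.emb.left a = f := ha.resolve_right fun h =>
      hla.not_symm (by rwa [← h, isPositive_left] at hf)
    have hb' : I.emb.left b = f := hb.resolve_right fun h =>
      hlb.not_symm (by rwa [← h, isPositive_left] at hf)
    refine I.emb.next.injective (hpoly _ _ ?_ ?_ ?_ ?_)
    · rw [I.emb.left_next, I.emb.left_next, ha', hb']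
    · rwa [I.emb.left_next, ha']
    · rwa [I.emb.left_next, ha']
    · rw [I.emb.next_fst, I.emb.next_fst, hab]
  · have ha' : I.emb.left a.symm = f := ha.resolve_left fun h =>
      hf (by rwa [← h, isPositive_left])
    have hb' : I.emb.left b.symm = f := hb.resolve_left fun h =>
      hf (by rwa [← h, isPositive_left])
    exact SimpleGraph.Dart.symm_involutive.injective
      (hpoly _ _ (ha'.trans hb'.symm) (ha' ▸ hc) (ha' ▸ ho) hab)

theorem exists_isMinimalVeblen (hpoly : I.FacesArePolygons)
    (h : I.IsPositive I.central ↔ I.IsPositive I.outer) :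
    ∃ 𝒟 : Set I.Circuit, IsMinimalVeblen 𝒟 := by
  have key : ∃ 𝒟 : Set I.Circuit, IsDecomposition 𝒟 ∧
      ∀ γ ∈ 𝒟, ∃ f, ¬ (I.IsPositive f ↔ I.IsPositive I.central) ∧ γ.Bounds f := by
    by_cases hc : I.IsPositive I.central
    · simpa [hc] using exists_isDecomposition_negative
    · simpa [hc] using exists_isDecomposition_positive
  obtain ⟨𝒟, h𝒟, hb⟩ := key
  refine ⟨𝒟, h𝒟, fun γ hγ => ?_⟩
  obtain ⟨f, hf, hb⟩ := hb γ hγ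
  have hc : f ≠ I.central := by rintro rfl; exact hf Iff.rfl
  have ho : f ≠ I.outer := by rintro rfl; exact hf h.symm
  exact ⟨hb.isSimple hpoly hc ho, f, hc, ho, hb⟩

theorem IsMinimalVeblen.isPositive_iff {𝒟 : Set I.Circuit} (h : IsMinimalVeblen 𝒟) :
    I.IsPositive I.central ↔ I.IsPositive I.outer := by
  obtain ⟨l, hl⟩ := I.emb.exists_isDualWalk I.connected I.central I.outer
  have hsum := h.1.sum_crossing hl
  rw [Finset.sum_eq_zero] at hsum
  · split_ifs at hsum <;> simp_all
  · intro γ hγ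
    obtain ⟨-, f, hc, ho, hb⟩ := h.2 γ (by simpa using hγ)
    rw [hb.crossing hl, if_neg hc.symm, if_neg ho.symm, sub_zero, mul_zero]

theorem Circuit.IsSingleSurrounding.crossing {γ : I.Circuit} (h : γ.IsSingleSurrounding)
    {l : List I.graph.Dart} (hl : I.emb.IsDualWalk I.central l I.outer) :
    γ.crossing l =
      (if I.IsPositive I.central then 1 else 0) - (if I.IsPositive I.outer then 1 else 0) := by
  obtain ⟨-, 𝒟, h𝒟, hγ, hδ⟩ := h
  rw [← h𝒟.sum_crossing hl, Finset.sum_eq_single_of_mem γ (by simpa using hγ)]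
  intro δ hδ' hne
  exact crossing_eq_zero_of_not_surrounds (fun hs => hne (hδ δ (by simpa using hδ') hs)) hl

theorem Circuit.IsSingleSurrounding.not_isPositive_iff {γ : I.Circuit}
    (h : γ.IsSingleSurrounding) : ¬ (I.IsPositive I.central ↔ I.IsPositive I.outer) := by
  intro hiff
  obtain ⟨l, hl⟩ := I.emb.exists_isDualWalk I.connected I.central I.outer
  obtain ⟨w, hw, hwind⟩ := h.1
  have h1 := h.crossing hl
  rw [hwind l hl] at h1
  simp only [hiff, sub_self] at h1
  exact hw h1

theorem exists_isSingleSurrounding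
    (h : ¬ (I.IsPositive I.central ↔ I.IsPositive I.outer)) :
    ∃ γ : I.Circuit, γ.IsSingleSurrounding := by
  obtain ⟨𝒟, h𝒟, hb⟩ := exists_isDecomposition_positive (I := I)
  -- `g` is the one positive distinguished face; every other positive face has a boundary of winding
  -- number 0.
  obtain ⟨g, hg, hg'⟩ : ∃ g, I.IsPositive g ∧
      ∀ f, I.IsPositive f → (f = I.central ∨ f = I.outer) → f = g := by
    by_cases hc : I.IsPositive I.central
    · refine ⟨I.central, hc, ?_⟩
      rintro f hf (rfl | rfl)
      · rfl
      · exact absurd ⟨fun _ => hf, fun _ => hc⟩ h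
    · refine ⟨I.outer, by tauto, ?_⟩
      rintro f hf (rfl | rfl)
      · exact absurd hf hc
      · rfl
  have hg0 : g = I.central ∨ g = I.outer := by
    by_cases hc : I.IsPositive I.central
    · exact .inl (hg' _ hc (.inl rfl)).symm
    · exact .inr (hg' _ (by tauto) (.inr rfl)).symm
  obtain ⟨d, rfl⟩ := I.emb.left_surjective g
  have hd : I.IsLink d := by simpa using hg
  obtain ⟨γ, ⟨hγ, hdγ⟩, huniq⟩ := h𝒟 d hd
  have hbd : ∀ δ ∈ 𝒟, δ ≠ γ → ∀ f, I.IsPositive f → δ.Bounds f → f ≠ I.emb.left d := by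
    rintro δ hδ hne f hf hδb rfl
    exact hne (huniq δ ⟨hδ, (hδb d).2 ⟨hd, .inl rfl⟩⟩)
  obtain ⟨f, hf, hγb⟩ := hb γ hγ
  obtain rfl : I.emb.left d = f := ((hγb d).1 hdγ).2.resolve_right fun h =>
    hd.not_symm (by rwa [← h, isPositive_left] at hf)
  refine ⟨γ, ⟨_, ?_, fun l hl => hγb.crossing hl⟩, 𝒟, h𝒟, hγ, fun δ hδ hs => ?_⟩
  · have hne := I.central_ne_outer
    rw [if_pos hf]
    rcases hg0 with h0 | h0
    · simp [h0, hne.symm]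
    · simp [h0, hne]
  · by_contra hne
    obtain ⟨f, hf, hδb⟩ := hb δ hδ
    have hfd := hbd δ hδ hne f hf hδb
    obtain ⟨w, hw, hwind⟩ := hs
    obtain ⟨l, hl⟩ := I.emb.exists_isDualWalk I.connected I.central I.outer
    apply hw
    rw [← hwind l hl, hδb.crossing hl,
      if_neg (c := I.central = f) fun h => hfd (hg' f hf (.inl h.symm)),
      if_neg (c := I.outer = f) fun h => hfd (hg' f hf (.inr h.symm)), sub_zero, mul_zero]

end CoronaGraph

theorem mainTheorem3 {V : Type*} [Fintype V] (I : CoronaGraph V)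
    (hpoly : I.FacesArePolygons) :
    ((∃ γ : I.Circuit, γ.IsSingleSurrounding) ↔
      ¬ ∃ 𝒟 : Set I.Circuit, CoronaGraph.IsMinimalVeblen 𝒟) ∧
    (∃ ε : ℤ, (ε = 1 ∨ ε = -1) ∧
      ∀ γ : I.Circuit, γ.IsSingleSurrounding → γ.HasWindingNumber ε) := by
  refine ⟨⟨?_, ?_⟩, ?_⟩
  · rintro ⟨γ, hγ⟩ ⟨𝒟, h𝒟⟩
    exact hγ.not_isPositive_iff h𝒟.isPositive_iff
  · intro h
    exact CoronaGraph.exists_isSingleSurrounding fun h' =>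
      h (CoronaGraph.exists_isMinimalVeblen hpoly h')
  · refine ⟨if I.IsPositive I.central then 1 else -1, by split_ifs <;> simp, ?_⟩
    intro γ hγ l hl
    have h := hγ.not_isPositive_iff
    rw [hγ.crossing hl]
    by_cases h1 : I.IsPositive I.central <;> by_cases h2 : I.IsPositive I.outer <;>
      simp_all
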